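/- Let $X$ be a complex Hilbert space and let $T$ be a bounded linear operator on $X$ that is strongly Kreiss bounded with constant $K_s$, that is, every $\lambda\in\mathbb{C}$ with $|\lambda|>1$ belongs to the resolvent set of $T$ and $$\|(\lambda-T)^{-n}\|\leq \frac{K_s}{(|\lambda|-1)^{n}}\qquad\text{for all } |\lambda|>1 \text{ and all integers } n\geq 1.$$ Then there exist constants $C,\beta>0$ depending only on $K_s$ (not on $X$ or $T$) such that $$\|T^n\|\leq C\,(\log(n+2))^{\beta}\qquad\text{for all integers } n\geq 1.$$ -/

import Mathlib

/-- A bounded operator `T` on a complex normed space `X` is strongly Kreiss bounded with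
constant `K` if every `z : ℂ` with `|z| > 1` lies in the resolvent set of `T` and
`‖(z - T)⁻ⁿ‖ ≤ K / (|z| - 1)ⁿ` for all `n ≥ 1`. -/
def StronglyKreissBounded {X : Type*} [NormedAddCommGroup X] [NormedSpace ℂ X]
    (T : X →L[ℂ] X) (K : ℝ) : Prop :=
  ∀ z : ℂ, 1 < ‖z‖ →
    z ∈ resolventSet ℂ T ∧
      ∀ n : ℕ, 1 ≤ n → ‖resolvent T z ^ n‖ ≤ K / (‖z‖ - 1) ^ n

open Filter Topology MeasureTheory AddCircle

/-! On `|z| = 2`, expanding the power `d + 1` of the resolvent turns the hypothesis into a bound by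
`K` on `∑ u ^ k w_k T ^ k` for every unimodular `u`, where `w` is the negative binomial law of mean
`d + 1` and variance `2 (d + 1)`. By Parseval, convolution with the operator sequence `w_k T ^ k` is
then bounded by `K` on square-summable sequences (`norm_sum_inner_le`).

Take `d + 1 = m ^ 2`. The law has width of order `m`, so applying this to the orbit segment `T ^ j
x`, `j < 9 m`, recovers a fixed share of each `T ^ l x` for `l` in a window of length `2 m + 3` near
`m ^ 2`: the energy there is at most `4 K ^ 2` times that of the first `9 m` iterates. These windows
tile the integers from 3 on, so a linear energy bound at scale `M` passes to scale `M ^ 2` at the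
cost of one constant factor. About `log log n` squarings reach `n`, which gives a power of `log n`.

Pairing the averaged bounds for `T` and its adjoint over one window yields the bound on `‖T ^ n‖`.
-/

/-! ### Resolvent powers as negative binomial series. -/

theorem spectralRadius_le_one_of_stronglyKreissBounded {X : Type*} [NormedAddCommGroup X]
    [NormedSpace ℂ X] {T : X →L[ℂ] X} {K : ℝ} (hT : StronglyKreissBounded T K) :
    spectralRadius ℂ T ≤ 1 := by
  refine iSup₂_le fun z hz => ?_
  by_contra hlt
  push Not at hlt
  have h1 : 1 < ‖z‖ := by
    have : (1 : NNReal) < ‖z‖₊ := by exact_mod_cast hlt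
    exact_mod_cast this
  exact hz (hT z h1).1

theorem summable_choose_mul_norm_pow {A : Type*} [NormedRing A] [NormedAlgebra ℂ A]
    [CompleteSpace A] {a : A} (ha : spectralRadius ℂ a ≤ 1) {r : ℝ} (hr0 : 0 ≤ r) (hr : r < 1)
    (d : ℕ) : Summable fun n : ℕ => ((n + d).choose d : ℝ) * (r ^ n * ‖a ^ n‖) := by
  obtain ⟨q, hq1, hq⟩ : ∃ q : ℝ, 1 < q ∧ r * q < 1 := by
    refine ⟨2 / (1 + r), ?_, ?_⟩
    · rw [lt_div_iff₀ (by linarith)]; linarith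
    · rw [mul_div_assoc', div_lt_one (by linarith)]; linarith
  have hev : ∀ᶠ n : ℕ in atTop, ‖a ^ n‖ ≤ q ^ n := by
    have hlim := spectrum.pow_nnnorm_pow_one_div_tendsto_nhds_spectralRadius a
    have hlt : spectralRadius ℂ a < ENNReal.ofReal q :=
      ha.trans_lt (by
        rw [← ENNReal.ofReal_one]
        exact (ENNReal.ofReal_lt_ofReal_iff (by linarith)).2 hq1)
    filter_upwards [hlim.eventually (gt_mem_nhds hlt), eventually_ge_atTop 1] with n hn hn1
    have h2 := ENNReal.rpow_le_rpow hn.le (Nat.cast_nonneg (α := ℝ) n)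
    rw [← ENNReal.rpow_mul, one_div, inv_mul_cancel₀ (by positivity), ENNReal.rpow_one,
      ENNReal.rpow_natCast, ← ENNReal.ofReal_pow (by linarith), ← enorm_eq_nnnorm,
      ← ofReal_norm] at h2
    exact (ENNReal.ofReal_le_ofReal_iff (by positivity)).1 h2
  have hs : Summable fun n : ℕ => ((n + d).choose d : ℝ) * (r * q) ^ n :=
    summable_choose_mul_geometric_of_norm_lt_one d (by
      rw [Real.norm_of_nonneg (by positivity)]; exact hq)
  refine Summable.of_norm_bounded_eventually_nat hs ?_
  filter_upwards [hev] with n hn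
  rw [Real.norm_of_nonneg (by positivity), mul_pow]
  gcongr

theorem one_sub_pow_mul_tsum_choose_mul_pow {A : Type*} [NormedRing A] [CompleteSpace A] {a : A}
    (ha : ∀ d : ℕ, Summable fun n : ℕ => ((n + d).choose d : A) * a ^ n) (d : ℕ) :
    (1 - a) ^ (d + 1) * ∑' n : ℕ, ((n + d).choose d : A) * a ^ n = 1 := by
  have zero : (1 - a) * ∑' n : ℕ, ((n + 0).choose 0 : A) * a ^ n = 1 := by
    have h0 := ha 0
    simp only [add_zero, Nat.choose_zero_right, Nat.cast_one, one_mul] at h0 ⊢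
    rw [sub_mul, one_mul, ← h0.tsum_mul_left a, sub_eq_iff_eq_add, h0.tsum_eq_zero_add]
    simp [pow_succ']
  -- Pascal's rule: each factor `1 - a` lowers the order of the series by one.
  have step (d : ℕ) : (1 - a) * ∑' n : ℕ, ((n + (d + 1)).choose (d + 1) : A) * a ^ n =
      ∑' n : ℕ, ((n + d).choose d : A) * a ^ n := by
    have h1 := ha (d + 1)
    have hd := ha d
    rw [sub_mul, one_mul, ← h1.tsum_mul_left a, sub_eq_iff_eq_add, h1.tsum_eq_zero_add,
      hd.tsum_eq_zero_add]
    have e : ∀ n : ℕ, ((n + 1 + (d + 1)).choose (d + 1) : A) * a ^ (n + 1) =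
        ((n + 1 + d).choose d : A) * a ^ (n + 1) +
          a * (((n + (d + 1)).choose (d + 1) : A) * a ^ n) := by
      intro n
      have hc : (n + 1 + (d + 1)).choose (d + 1) =
          (n + 1 + d).choose d + (n + (d + 1)).choose (d + 1) := by
        rw [show n + 1 + (d + 1) = n + 1 + d + 1 by ring, Nat.choose_succ_succ,
          show n + (d + 1) = n + 1 + d by ring]
      rw [hc, Nat.cast_add, add_mul, ← mul_assoc a ((n + (d + 1)).choose (d + 1) : A),
        ← (Nat.cast_commute ((n + (d + 1)).choose (d + 1)) a).eq, mul_assoc, ← pow_succ']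
    simp only [e]
    rw [((summable_nat_add_iff 1).2 hd).tsum_add (h1.mul_left a)]
    simp [add_assoc]
  induction d with
  | zero => simpa using zero
  | succ d ih => rw [pow_succ, mul_assoc, step, ih]

/-- The negative binomial distribution with parameters `d + 1` and `1 / 2`. -/
noncomputable def negBinomial (d k : ℕ) : ℝ := ((k + d).choose d : ℝ) * (1 / 2) ^ (k + d + 1)

theorem negBinomial_nonneg (d k : ℕ) : 0 ≤ negBinomial d k := by
  unfold negBinomial; positivity

section Series
variable {X : Type*} [NormedAddCommGroup X] [NormedSpace ℂ X] [CompleteSpace X]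
  {T : X →L[ℂ] X} {K : ℝ}

theorem StronglyKreissBounded.summable_negBinomial (hT : StronglyKreissBounded T K) (d : ℕ) :
    Summable fun k : ℕ => negBinomial d k * ‖T ^ k‖ := by
  refine ((summable_choose_mul_norm_pow (spectralRadius_le_one_of_stronglyKreissBounded hT)
    (by norm_num : (0 : ℝ) ≤ 1 / 2) (by norm_num) d).mul_left ((1 / 2 : ℝ) ^ (d + 1))).congr
    fun k => ?_
  rw [negBinomial]
  ring

/-- With `z = 2 / u` the sum equals, up to a unimodular factor, the power `d + 1` of the resolvent
at `z`, and `|z| - 1 = 1`, so the bound is `K` for every `d`. -/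
theorem StronglyKreissBounded.norm_tsum_negBinomial_le (hT : StronglyKreissBounded T K) (d : ℕ)
    {u : ℂ} (hu : ‖u‖ = 1) :
    ‖∑' k : ℕ, (u ^ k * negBinomial d k) • T ^ k‖ ≤ K := by
  have hu0 : u ≠ 0 := by rintro rfl; simp at hu
  set b : ℂ := u / 2 with hb
  have hb0 : b ≠ 0 := by simp [hb, hu0]
  have hbn : ‖b‖ = 1 / 2 := by simp [hb, hu]
  set a : X →L[ℂ] X := b • T with ha
  have hsum (d : ℕ) : Summable fun n : ℕ => ((n + d).choose d : X →L[ℂ] X) * a ^ n := by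
    refine Summable.of_norm_bounded (summable_choose_mul_norm_pow
      (spectralRadius_le_one_of_stronglyKreissBounded hT)
      (by norm_num : (0 : ℝ) ≤ 1 / 2) (by norm_num) d) fun n => ?_
    rw [← nsmul_eq_mul, ← Nat.cast_smul_eq_nsmul ℂ, norm_smul, ha, smul_pow, norm_smul, norm_pow,
      hbn, Complex.norm_natCast]
  have hG := one_sub_pow_mul_tsum_choose_mul_pow hsum d
  set G := ∑' n : ℕ, ((n + d).choose d : X →L[ℂ] X) * a ^ n with hGdef
  have hz : ‖b⁻¹‖ = 2 := by rw [norm_inv, hbn]; norm_num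
  obtain ⟨hres, hpow⟩ := hT b⁻¹ (by rw [hz]; norm_num)
  have hR : resolvent T b⁻¹ * (algebraMap ℂ (X →L[ℂ] X) b⁻¹ - T) = 1 :=
    Ring.inverse_mul_cancel _ hres
  have hR' : (algebraMap ℂ (X →L[ℂ] X) b⁻¹ - T) * resolvent T b⁻¹ = 1 :=
    Ring.mul_inverse_cancel _ hres
  have h1a : (1 - a) = b • (algebraMap ℂ (X →L[ℂ] X) b⁻¹ - T) := by
    rw [smul_sub, ha, Algebra.algebraMap_eq_smul_one, smul_smul, mul_inv_cancel₀ hb0, one_smul]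
  have hGeq : b ^ (d + 1) • G = resolvent T b⁻¹ ^ (d + 1) := by
    have hc : Commute (resolvent T b⁻¹) (algebraMap ℂ (X →L[ℂ] X) b⁻¹ - T) := hR.trans hR'.symm
    rw [h1a, smul_pow, smul_mul_assoc, ← mul_smul_comm] at hG
    calc b ^ (d + 1) • G = (resolvent T b⁻¹ * (algebraMap ℂ (X →L[ℂ] X) b⁻¹ - T)) ^ (d + 1) *
          (b ^ (d + 1) • G) := by rw [hR, one_pow, one_mul]
      _ = resolvent T b⁻¹ ^ (d + 1) := by rw [hc.mul_pow, mul_assoc, hG, mul_one]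
  have hF : ∑' k : ℕ, (u ^ k * negBinomial d k) • T ^ k = ((1 / 2 : ℂ) ^ (d + 1)) • G := by
    rw [hGdef, ← (hsum d).tsum_const_smul]
    refine tsum_congr fun k => ?_
    rw [← nsmul_eq_mul, ← Nat.cast_smul_eq_nsmul ℂ, ha, smul_pow, smul_smul, smul_smul, hb,
      negBinomial]
    congr 1
    push_cast
    ring
  rw [hF, norm_smul]
  have h2 := hpow (d + 1) (by omega)
  rw [← hGeq, norm_smul, norm_pow, hbn, hz] at h2
  rw [norm_pow]
  norm_num at h2 ⊢
  exact h2
end Series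

/-! ### Parseval and the convolution bound. -/

theorem integral_fourier_haarAddCircle (n : ℤ) :
    ∫ x : AddCircle (1 : ℝ), fourier n x ∂haarAddCircle = if n = 0 then 1 else 0 := by
  split_ifs with h
  · subst h; simp
  · exact integral_eq_zero_of_add_right_eq_neg (fourier_add_half_inv_index h one_pos)

theorem Continuous.integrable_haarAddCircle {E : Type*} [NormedAddCommGroup E]
    {f : AddCircle (1 : ℝ) → E} (hf : Continuous f) : Integrable f haarAddCircle :=
  hf.integrable_of_hasCompactSupport (HasCompactSupport.of_compactSpace f)

theorem integral_mul_le_sqrt_mul_sqrt {f g : AddCircle (1 : ℝ) → ℝ} (hf : Continuous f)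
    (hg : Continuous g) (hf0 : ∀ x, 0 ≤ f x) (hg0 : ∀ x, 0 ≤ g x) :
    ∫ x, f x * g x ∂haarAddCircle ≤
      √(∫ x, f x ^ 2 ∂haarAddCircle) * √(∫ x, g x ^ 2 ∂haarAddCircle) := by
  have h := integral_mul_le_Lp_mul_Lq_of_nonneg (μ := haarAddCircle) Real.HolderConjugate.two_two
    (Filter.Eventually.of_forall hf0) (Filter.Eventually.of_forall hg0)
    (hf.memLp_of_hasCompactSupport (HasCompactSupport.of_compactSpace f))
    (hg.memLp_of_hasCompactSupport (HasCompactSupport.of_compactSpace g))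
  simpa [Real.sqrt_eq_rpow] using h

section Parseval
variable {X : Type*} [NormedAddCommGroup X] [InnerProductSpace ℂ X]

theorem inner_fourier_smul_fourier_smul (m n : ℤ) (θ : AddCircle (1 : ℝ)) (x y : X) :
    inner ℂ (fourier m θ • x) (fourier n θ • y) = fourier (n - m) θ * inner ℂ x y := by
  rw [inner_smul_left, inner_smul_right, sub_eq_add_neg, fourier_add, fourier_neg]
  ring

theorem integral_norm_sq_sum_fourier_smul (s : Finset ℕ) (g : ℕ → X) :
    ∫ θ : AddCircle (1 : ℝ), ‖∑ j ∈ s, fourier (j : ℤ) θ • g j‖ ^ 2 ∂haarAddCircle =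
      ∑ j ∈ s, ‖g j‖ ^ 2 := by
  have key : ∫ θ : AddCircle (1 : ℝ), (inner ℂ (∑ j ∈ s, fourier (j : ℤ) θ • g j)
      (∑ j ∈ s, fourier (j : ℤ) θ • g j)) ∂haarAddCircle = ∑ j ∈ s, inner ℂ (g j) (g j) := by
    simp only [sum_inner, inner_sum, inner_fourier_smul_fourier_smul]
    rw [integral_finsetSum _ fun i _ => Continuous.integrable_haarAddCircle (by fun_prop)]
    refine Finset.sum_congr rfl fun i hi => ?_
    rw [integral_finsetSum _ fun i _ => Continuous.integrable_haarAddCircle (by fun_prop)]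
    simp only [integral_mul_const, integral_fourier_haarAddCircle, sub_eq_zero, Nat.cast_inj]
    simp [hi]
  simp only [inner_self_eq_norm_sq_to_K] at key
  have := congrArg Complex.re key
  norm_cast at this

end Parseval

section Bilinear
variable {X : Type*} [NormedAddCommGroup X] [InnerProductSpace ℂ X] [CompleteSpace X]
  {T : X →L[ℂ] X} {K : ℝ}

/-- The left side is the integral over the circle of `⟨H, F G⟩`, with `G`, `H` the trigonometric
polynomials of `g`, `h` and `F` the operator series of norm at most `K`. Orthogonality keeps only
the terms `k + j = l`; Cauchy–Schwarz and Parseval finish. -/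
theorem StronglyKreissBounded.norm_sum_inner_le (hT : StronglyKreissBounded T K) (d : ℕ)
    (s t : Finset ℕ) (g h : ℕ → X) :
    ‖∑ l ∈ t, ∑ j ∈ s, if j ≤ l then
        (negBinomial d (l - j) : ℂ) * inner ℂ (h l) ((T ^ (l - j)) (g j)) else 0‖ ≤
      K * (√(∑ j ∈ s, ‖g j‖ ^ 2) * √(∑ l ∈ t, ‖h l‖ ^ 2)) := by
  have hK : 0 ≤ K := (norm_nonneg _).trans (hT.norm_tsum_negBinomial_le d (u := 1) (by simp))
  set G : AddCircle (1 : ℝ) → X := fun θ => ∑ j ∈ s, fourier (j : ℤ) θ • g j with hG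
  set H : AddCircle (1 : ℝ) → X := fun θ => ∑ l ∈ t, fourier (l : ℤ) θ • h l with hH
  have hGc : Continuous G := by fun_prop
  have hHc : Continuous H := by fun_prop
  set Φ : ℕ → AddCircle (1 : ℝ) → ℂ := fun k θ =>
    inner ℂ (H θ) (((fourier 1 θ ^ k * negBinomial d k) • T ^ k) (G θ)) with hΦ
  have hΦc (k : ℕ) : Continuous (Φ k) := by
    refine hHc.inner ?_
    simp only [smul_apply]
    exact (by fun_prop : Continuous fun θ : AddCircle (1 : ℝ) =>
      (fourier 1 θ ^ k * (negBinomial d k : ℂ))).smul ((T ^ k).continuous.comp hGc)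
  have hun (θ : AddCircle (1 : ℝ)) : ‖(fourier 1 θ : ℂ)‖ = 1 := by
    rw [fourier_apply]; exact Circle.norm_coe _
  have hopn (k : ℕ) (θ : AddCircle (1 : ℝ)) :
      ‖(fourier 1 θ ^ k * (negBinomial d k : ℂ)) • T ^ k‖ = negBinomial d k * ‖T ^ k‖ := by
    rw [norm_smul, norm_mul, norm_pow, hun, one_pow, one_mul, Complex.norm_real,
      Real.norm_of_nonneg (negBinomial_nonneg d k)]
  have hΦn (k : ℕ) (θ : AddCircle (1 : ℝ)) :
      ‖Φ k θ‖ ≤ negBinomial d k * ‖T ^ k‖ * (‖H θ‖ * ‖G θ‖) := by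
    refine (norm_inner_le_norm _ _).trans ?_
    calc _ ≤ ‖H θ‖ * (‖(fourier 1 θ ^ k * (negBinomial d k : ℂ)) • T ^ k‖ * ‖G θ‖) := by
          gcongr; exact ContinuousLinearMap.le_opNorm _ _
      _ = _ := by rw [hopn]; ring
  have hGHc : Continuous fun θ => ‖H θ‖ * ‖G θ‖ := by fun_prop
  have hsum : Summable fun k => ∫ θ, ‖Φ k θ‖ ∂haarAddCircle := by
    refine Summable.of_nonneg_of_le (fun k => integral_nonneg fun θ => norm_nonneg _) (fun k => ?_)
      ((hT.summable_negBinomial d).mul_right (∫ θ, ‖H θ‖ * ‖G θ‖ ∂haarAddCircle))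
    rw [← integral_const_mul]
    exact integral_mono (hΦc k).norm.integrable_haarAddCircle
      (hGHc.integrable_haarAddCircle.const_mul _) (hΦn k)
  have hHS := hasSum_integral_of_summable_integral_norm
    (fun k => (hΦc k).integrable_haarAddCircle) hsum
  have hint (k : ℕ) : ∫ θ, Φ k θ ∂haarAddCircle = ∑ l ∈ t, ∑ j ∈ s,
      if k + j = l then (negBinomial d k : ℂ) * inner ℂ (h l) ((T ^ k) (g j)) else 0 := by
    have e (θ : AddCircle (1 : ℝ)) : Φ k θ = ∑ l ∈ t, ∑ j ∈ s,
        fourier ((k : ℤ) + j - l) θ *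
          ((negBinomial d k : ℂ) * inner ℂ (h l) ((T ^ k) (g j))) := by
      simp only [hΦ, hH, hG, sum_inner, smul_apply, map_sum, map_smul,
        inner_sum, inner_smul_left, inner_smul_right, sub_eq_add_neg, fourier_add, fourier_neg,
        Finset.mul_sum]
      rw [Finset.sum_comm]
      refine Finset.sum_congr rfl fun l _ => Finset.sum_congr rfl fun j _ => ?_
      have : fourier (k : ℤ) θ = fourier 1 θ ^ k := by
        rw [fourier_apply, fourier_apply, one_zsmul, natCast_zsmul, AddCircle.toCircle_nsmul]
        simp
      rw [this]
      ring
    simp only [e]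
    rw [integral_finsetSum _ fun i _ => Continuous.integrable_haarAddCircle (by fun_prop)]
    refine Finset.sum_congr rfl fun l hl => ?_
    rw [integral_finsetSum _ fun i _ => Continuous.integrable_haarAddCircle (by fun_prop)]
    refine Finset.sum_congr rfl fun j hj => ?_
    rw [integral_mul_const, integral_fourier_haarAddCircle]
    simp only [sub_eq_zero, ← Nat.cast_add, Nat.cast_inj]
    split_ifs <;> simp
  simp only [hint] at hHS
  have hHS' : HasSum (fun k : ℕ => ∑ l ∈ t, ∑ j ∈ s,
      if k + j = l then (negBinomial d k : ℂ) * inner ℂ (h l) ((T ^ k) (g j)) else 0)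
      (∑ l ∈ t, ∑ j ∈ s, if j ≤ l then
        (negBinomial d (l - j) : ℂ) * inner ℂ (h l) ((T ^ (l - j)) (g j)) else 0) := by
    refine hasSum_sum fun l _ => hasSum_sum fun j _ => ?_
    split_ifs with hjl
    · convert hasSum_single (l - j) fun k hk => if_neg (show ¬ k + j = l by omega) using 1
      rw [if_pos (by omega)]
    · convert hasSum_zero (α := ℂ) (β := ℕ) using 2 with k
      rw [if_neg (by omega)]
  rw [hHS'.unique hHS]
  have hbound (θ : AddCircle (1 : ℝ)) : ‖∑' k, Φ k θ‖ ≤ K * (‖G θ‖ * ‖H θ‖) := by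
    have hs : Summable fun k : ℕ => (fourier 1 θ ^ k * (negBinomial d k : ℂ)) • T ^ k :=
      Summable.of_norm_bounded (hT.summable_negBinomial d) fun k => (hopn k θ).le
    have e : ∑' k, Φ k θ = inner ℂ (H θ)
        ((∑' k : ℕ, (fourier 1 θ ^ k * (negBinomial d k : ℂ)) • T ^ k) (G θ)) := by
      have h1 := (hs.hasSum.mapL (ContinuousLinearMap.apply ℂ X (G θ))).mapL
        (innerSL ℂ (H θ))
      exact h1.tsum_eq
    rw [e]
    refine (norm_inner_le_norm _ _).trans ?_
    calc _ ≤ ‖H θ‖ * (K * ‖G θ‖) := by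
          gcongr
          exact (ContinuousLinearMap.le_opNorm _ _).trans
            (mul_le_mul_of_nonneg_right (hT.norm_tsum_negBinomial_le d (hun θ)) (norm_nonneg _))
      _ = _ := by ring
  refine (norm_integral_le_of_norm_le
    (((hGc.norm.mul hHc.norm).integrable_haarAddCircle).const_mul K)
    (Filter.Eventually.of_forall hbound)).trans ?_
  rw [integral_const_mul]
  gcongr
  refine (integral_mul_le_sqrt_mul_sqrt hGc.norm hHc.norm (fun _ => norm_nonneg _)
    fun _ => norm_nonneg _).trans ?_
  rw [integral_norm_sq_sum_fourier_smul, integral_norm_sq_sum_fourier_smul]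
end Bilinear

/-! ### Concentration of the negative binomial law. -/

theorem hasSum_negBinomial (d : ℕ) : HasSum (negBinomial d) 1 := by
  have h := (hasSum_choose_mul_geometric_of_norm_lt_one d (r := (1 / 2 : ℝ))
    (by norm_num)).mul_left ((1 / 2 : ℝ) ^ (d + 1))
  have e : (fun k : ℕ => (1 / 2 : ℝ) ^ (d + 1) * (((k + d).choose d : ℝ) * (1 / 2) ^ k)) =
      negBinomial d := by
    funext k
    rw [negBinomial]
    ring
  rwa [e, mul_one_div, show (1 - 1 / 2 : ℝ) = 1 / 2 by norm_num, div_self (by positivity)] at h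

theorem add_mul_negBinomial (d k : ℕ) :
    ((k : ℝ) + d + 1) * negBinomial d k = 2 * (d + 1) * negBinomial (d + 1) k := by
  have h : ((k + d : ℕ) + 1 : ℝ) * ((k + d).choose d : ℝ) =
      ((k + d + 1).choose (d + 1) : ℝ) * (d + 1) := by
    exact_mod_cast Nat.add_one_mul_choose_eq (k + d) d
  push_cast at h
  rw [negBinomial, negBinomial, ← mul_assoc, h, show k + (d + 1) = k + d + 1 by ring,
    pow_succ (1 / 2 : ℝ) (k + d + 1)]
  ring

theorem hasSum_negBinomial_mul_sq (d : ℕ) :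
    HasSum (fun k : ℕ => negBinomial d k * ((k : ℝ) - (d + 1)) ^ 2) (2 * ((d : ℝ) + 1)) := by
  -- With `s = d + 1`, `(k - s) ^ 2 = (k + s) (k + s + 1) - (4 s + 1) (k + s) + 4 s ^ 2`, and each
  -- rising factor raises the order of the law by one.
  have h := (((hasSum_negBinomial (d + 2)).mul_left (4 * ((d : ℝ) + 1) * (d + 2))).sub
    ((hasSum_negBinomial (d + 1)).mul_left ((4 * ((d : ℝ) + 1) + 1) * (2 * (d + 1))))).add
    ((hasSum_negBinomial d).mul_left (4 * ((d : ℝ) + 1) ^ 2))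
  refine (congrArg₂ (fun f a => HasSum f a) (funext fun k => ?_) (by ring)).mp h
  have h1 := add_mul_negBinomial d k
  have h2 := add_mul_negBinomial (d + 1) k
  push_cast at h2
  linear_combination -((k : ℝ) + d + 1 - 4 * (d + 1)) * h1 - 2 * ((d : ℝ) + 1) * h2

/-- Chebyshev's inequality for the negative binomial distribution. -/
theorem half_le_sum_negBinomial {d m : ℕ} (hd : d + 1 = m ^ 2) (J : Finset ℕ)
    (hJ : ∀ k : ℕ, m ^ 2 < k + 2 * m → k < m ^ 2 + 2 * m → k ∈ J) :
    1 / 2 ≤ ∑ k ∈ J, negBinomial d k := by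
  have hm : 0 < m := Nat.pos_of_ne_zero (by rintro rfl; simp at hd)
  have hd' : (d : ℝ) + 1 = (m : ℝ) ^ 2 := by exact_mod_cast hd
  have hm' : (0 : ℝ) < m := by exact_mod_cast hm
  have hJsum : HasSum (fun k => if k ∈ J then negBinomial d k else 0)
      (∑ k ∈ J, negBinomial d k) := by
    rw [← Finset.sum_congr rfl fun k hk => if_pos hk]
    exact hasSum_sum_of_ne_finset_zero fun k hk => if_neg hk
  have h1 := hJsum.add ((hasSum_negBinomial_mul_sq d).div_const (4 * (m : ℝ) ^ 2))
  suffices h : ∀ k, negBinomial d k ≤ (if k ∈ J then negBinomial d k else 0) +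
      negBinomial d k * ((k : ℝ) - (d + 1)) ^ 2 / (4 * (m : ℝ) ^ 2) by
    have h2 := hasSum_le h (hasSum_negBinomial d) h1
    have : 2 * (m : ℝ) ^ 2 / (4 * m ^ 2) = 1 / 2 := by field_simp; norm_num
    rw [hd', this] at h2
    linarith
  · intro k
    have hw := negBinomial_nonneg d k
    split_ifs with hk
    · have : 0 ≤ negBinomial d k * ((k : ℝ) - (d + 1)) ^ 2 / (4 * (m : ℝ) ^ 2) := by positivity
      linarith
    · rw [zero_add, le_div_iff₀ (by positivity), hd']
      gcongr
      rw [show 4 * (m : ℝ) ^ 2 = (2 * m) ^ 2 by ring, sq_le_sq, abs_of_pos (by positivity)]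
      by_contra hlt
      push Not at hlt
      obtain ⟨ha, hb⟩ := abs_lt.1 hlt
      refine hk (hJ k ?_ ?_)
      · have : (m : ℝ) ^ 2 < k + 2 * m := by linarith
        exact_mod_cast this
      · have : (k : ℝ) < (m : ℝ) ^ 2 + 2 * m := by linarith
        exact_mod_cast this

/-- For `l` in the window, every `k` within `2 m` of the mean `m ^ 2` is `l - j` with `0 < j ≤ 6 m +
1 < 9 m`, so Chebyshev applies. -/
theorem half_le_sum_range_negBinomial {d m l : ℕ} (hd : d + 1 = m ^ 2) (hl : m ^ 2 + 2 * m ≤ l)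
    (hl' : l < (m + 1) ^ 2 + 2 * (m + 1)) :
    1 / 2 ≤ ∑ j ∈ Finset.range (9 * m), if j ≤ l then negBinomial d (l - j) else 0 := by
  have hm : 0 < m := Nat.pos_of_ne_zero (by rintro rfl; simp at hd)
  rw [← Finset.sum_filter, ← Finset.sum_image (f := negBinomial d) (g := fun j => l - j)]
  · refine half_le_sum_negBinomial hd _ fun k hk hk' => ?_
    refine Finset.mem_image.2 ⟨l - k, Finset.mem_filter.2 ⟨Finset.mem_range.2 ?_, ?_⟩, ?_⟩
    · have : (m + 1) ^ 2 = m ^ 2 + 2 * m + 1 := by ring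
      omega
    · omega
    · omega
  · intro i hi j hj hij
    simp only [Finset.coe_filter, Set.mem_ofPred_eq] at hi hj
    simp only at hij
    omega

/-! ### Energy of an orbit over windows. -/

section Averages
variable {X : Type*} [NormedAddCommGroup X] [InnerProductSpace ℂ X]

/-- The sum of `‖T ^ j x‖ ^ 2` over `j < n`. -/
noncomputable def orbitEnergy (T : X →L[ℂ] X) (x : X) (n : ℕ) : ℝ :=
  ∑ j ∈ Finset.range n, ‖(T ^ j) x‖ ^ 2

theorem orbitEnergy_mono (T : X →L[ℂ] X) (x : X) : Monotone (orbitEnergy T x) := fun _ _ h =>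
  Finset.sum_le_sum_of_subset_of_nonneg (Finset.range_mono h) fun _ _ _ => by positivity

theorem orbitEnergy_nonneg (T : X →L[ℂ] X) (x : X) (n : ℕ) : 0 ≤ orbitEnergy T x n :=
  Finset.sum_nonneg fun _ _ => by positivity

variable [CompleteSpace X] {T : X →L[ℂ] X} {K : ℝ}

theorem StronglyKreissBounded.nonneg (hT : StronglyKreissBounded T K) : 0 ≤ K :=
  (norm_nonneg _).trans (hT.norm_tsum_negBinomial_le 0 (u := 1) (by simp))

/-- Along an orbit `T ^ (l - j) T ^ j x = T ^ l x` does not depend on `j`, so the weights sum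
separately. -/
theorem StronglyKreissBounded.norm_sum_inner_orbit_le (hT : StronglyKreissBounded T K)
    (d n : ℕ) (x : X) (t : Finset ℕ) (h : ℕ → X) :
    ‖∑ l ∈ t, ((∑ j ∈ Finset.range n, if j ≤ l then negBinomial d (l - j) else 0 : ℝ) : ℂ) *
        inner ℂ (h l) ((T ^ l) x)‖ ≤
      K * (√(orbitEnergy T x n) * √(∑ l ∈ t, ‖h l‖ ^ 2)) := by
  refine le_of_eq_of_le ?_ (hT.norm_sum_inner_le d (Finset.range n) t (fun j => (T ^ j) x) h)
  congr 1
  refine Finset.sum_congr rfl fun l _ => ?_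
  rw [Complex.ofReal_sum, Finset.sum_mul]
  refine Finset.sum_congr rfl fun j _ => ?_
  split_ifs with hjl
  · rw [← mul_apply_eq_comp, ← pow_add, Nat.sub_add_cancel hjl]
  · simp

/-- A crude bound for starting the iteration: the single term `j = 0`, `l = n` with `d = 0` has
weight `2 ^ -(n + 1)`. -/
theorem StronglyKreissBounded.norm_pow_le (hT : StronglyKreissBounded T K) (n : ℕ) :
    ‖T ^ n‖ ≤ K * 2 ^ (n + 1) := by
  have hK := hT.nonneg
  refine ContinuousLinearMap.opNorm_le_bound _ (by positivity) fun x => ?_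
  have h := hT.norm_sum_inner_orbit_le 0 1 x {n} fun _ => (T ^ n) x
  simp only [orbitEnergy, Finset.sum_singleton, Finset.range_one, pow_zero,
    one_apply_eq_self, Nat.zero_le, if_true, negBinomial, norm_mul,
    inner_self_eq_norm_sq_to_K, Real.sqrt_sq (norm_nonneg _)] at h
  simp only [add_zero, Nat.choose_zero_right, Nat.cast_one, one_mul, tsub_zero, norm_pow,
    Complex.norm_real, Real.norm_of_nonneg (by positivity : (0 : ℝ) ≤ 1 / 2),
    RCLike.norm_ofReal, abs_norm] at h
  rcases (norm_nonneg ((T ^ n) x)).eq_or_lt with h0 | h0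
  · rw [← h0]; positivity
  · rw [sq, ← mul_assoc, ← mul_assoc] at h
    have h2 := le_of_mul_le_mul_right h h0
    rw [one_div, inv_pow, ← div_eq_inv_mul, div_le_iff₀ (by positivity)] at h2
    linarith

/-- Testing against `h l = T ^ l x` gives `V / 2 ≤ K √S √V`, with `V` the window energy and `S` the
initial energy. -/
theorem StronglyKreissBounded.sum_norm_sq_le (hT : StronglyKreissBounded T K) (x : X) {m : ℕ}
    (hm : 1 ≤ m) :
    ∑ l ∈ Finset.Ico (m ^ 2 + 2 * m) ((m + 1) ^ 2 + 2 * (m + 1)), ‖(T ^ l) x‖ ^ 2 ≤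
      4 * K ^ 2 * orbitEnergy T x (9 * m) := by
  have hK := hT.nonneg
  obtain ⟨d, hd⟩ : ∃ d, d + 1 = m ^ 2 := ⟨m ^ 2 - 1, Nat.sub_add_cancel (Nat.one_le_pow _ _ hm)⟩
  set t := Finset.Ico (m ^ 2 + 2 * m) ((m + 1) ^ 2 + 2 * (m + 1)) with ht
  set V := ∑ l ∈ t, ‖(T ^ l) x‖ ^ 2 with hV
  have hV0 : 0 ≤ V := Finset.sum_nonneg fun _ _ => by positivity
  have h := hT.norm_sum_inner_orbit_le d (9 * m) x t fun l => (T ^ l) x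
  have h1 : V / 2 ≤ ‖∑ l ∈ t, ((∑ j ∈ Finset.range (9 * m),
      if j ≤ l then negBinomial d (l - j) else 0 : ℝ) : ℂ) *
        inner ℂ ((T ^ l) x) ((T ^ l) x)‖ := by
    refine le_trans ?_ (Complex.re_le_norm _)
    rw [hV, Finset.sum_div, Complex.re_sum]
    refine Finset.sum_le_sum fun l hl => ?_
    rw [Finset.mem_Ico] at hl
    have hc := half_le_sum_range_negBinomial hd hl.1 hl.2
    rw [Complex.re_ofReal_mul]
    have : (inner ℂ ((T ^ l) x) ((T ^ l) x)).re = ‖(T ^ l) x‖ ^ 2 :=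
      inner_self_eq_norm_sq (𝕜 := ℂ) _
    rw [this]
    have := mul_le_mul_of_nonneg_right hc (sq_nonneg ‖(T ^ l) x‖)
    linarith
  have h2 := h1.trans h
  rw [← hV] at h2
  set S := orbitEnergy T x (9 * m)
  have hS : 0 ≤ S := orbitEnergy_nonneg _ _ _
  rcases hV0.eq_or_lt with h0 | h0
  · rw [← h0]; positivity
  · have h3 : √V ≤ 2 * K * √S := by
      have := Real.sqrt_pos.2 h0
      refine le_of_mul_le_mul_right ?_ this
      rw [Real.mul_self_sqrt hV0]
      linarith
    calc V = √V ^ 2 := (Real.sq_sqrt hV0).symm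
      _ ≤ (2 * K * √S) ^ 2 := by gcongr
      _ = _ := by rw [mul_pow, Real.sq_sqrt hS]; ring
end Averages

/-! ### Squaring the scale, and passing to single powers. -/

section Growth
variable {X : Type*} [NormedAddCommGroup X] [InnerProductSpace ℂ X]

/-- `T` satisfies `∑ j < q, ‖T ^ j x‖ ^ 2 ≤ D * q * ‖x‖ ^ 2` for all `x` and all `q ≤ n`. -/
def EnergyBound (T : X →L[ℂ] X) (n : ℕ) (D : ℝ) : Prop :=
  ∀ x : X, ∀ q ≤ n, orbitEnergy T x q ≤ D * q * ‖x‖ ^ 2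

variable [CompleteSpace X] {T : X →L[ℂ] X} {K : ℝ}

theorem StronglyKreissBounded.orbitEnergy_sq_le (hT : StronglyKreissBounded T K) {D : ℝ}
    (hD : 0 ≤ D) {M : ℕ} (hM : 1 ≤ M) (h : EnergyBound T (9 * M) D) (x : X) :
    orbitEnergy T x (M ^ 2 + 2 * M) ≤ D * (3 + 36 * K ^ 2 * M ^ 2) * ‖x‖ ^ 2 := by
  induction M, hM using Nat.le_induction with
  | base =>
    refine (h x 3 (by norm_num)).trans ?_
    push_cast
    gcongr
    nlinarith [sq_nonneg K]
  | succ M hM ih =>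
    have ih := ih fun x q hq => h x q (by omega)
    have hw := hT.sum_norm_sq_le x hM
    have hS := h x (9 * M) (by omega)
    rw [orbitEnergy, ← Finset.sum_range_add_sum_Ico _
      (by nlinarith : M ^ 2 + 2 * M ≤ (M + 1) ^ 2 + 2 * (M + 1))]
    rw [orbitEnergy] at ih
    have h1 := mul_le_mul_of_nonneg_left hS (by positivity : 0 ≤ 4 * K ^ 2)
    have h2 : 0 ≤ K ^ 2 * D * ‖x‖ ^ 2 * (M + 1) := by positivity
    rw [Nat.cast_mul, Nat.cast_ofNat] at h1
    rw [Nat.cast_add, Nat.cast_one]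
    refine (add_le_add ih (hw.trans h1)).trans ?_
    nlinarith

theorem StronglyKreissBounded.energyBound_sq (hT : StronglyKreissBounded T K) {D : ℝ}
    (hD : 0 ≤ D) {M : ℕ} (h : EnergyBound T (9 * M) D) :
    EnergyBound T (M ^ 2) ((3 + 72 * K ^ 2) * D) := by
  intro x q hq
  rcases Nat.eq_zero_or_pos q with rfl | hq0
  · simp [orbitEnergy]
  have hr1 : q ≤ (Nat.sqrt (q - 1) + 1) ^ 2 := by
    have := Nat.lt_succ_sqrt' (q - 1)
    rw [Nat.succ_eq_add_one] at this
    omega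
  -- The number squared is the ceiling of `√q`; rounding up at most doubles `q`, whence `72 = 2 *
  -- 36`.
  have hr2 : (Nat.sqrt (q - 1) + 1) ^ 2 ≤ 2 * q := by
    have := Nat.sqrt_le' (q - 1)
    have h3 : Nat.sqrt (q - 1) ≤ Nat.sqrt (q - 1) ^ 2 := Nat.le_self_pow two_ne_zero _
    have h4 : (Nat.sqrt (q - 1) + 1) ^ 2 =
        Nat.sqrt (q - 1) ^ 2 + 2 * Nat.sqrt (q - 1) + 1 := by ring
    have h5 : 2 * Nat.sqrt (q - 1) ≤ Nat.sqrt (q - 1) ^ 2 + 1 := by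
      have := two_mul_le_add_sq (Nat.sqrt (q - 1)) 1
      simpa using this
    omega
  have hr3 : Nat.sqrt (q - 1) + 1 ≤ M := by
    rw [Nat.succ_le_iff, Nat.sqrt_lt']
    omega
  set r := Nat.sqrt (q - 1) + 1 with hr
  have hb := hT.orbitEnergy_sq_le hD (by omega : 1 ≤ r)
    (fun x p hp => h x p (by omega)) x
  refine (orbitEnergy_mono T x (by omega : q ≤ r ^ 2 + 2 * r)).trans (hb.trans ?_)
  have h2 : (r : ℝ) ^ 2 ≤ 2 * q := by exact_mod_cast hr2
  have h1 : (1 : ℝ) ≤ q := by exact_mod_cast hq0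
  have h3 : 3 + 36 * K ^ 2 * (r : ℝ) ^ 2 ≤ (3 + 72 * K ^ 2) * q := by
    nlinarith [mul_le_mul_of_nonneg_left h2 (sq_nonneg K)]
  calc _ ≤ D * ((3 + 72 * K ^ 2) * q) * ‖x‖ ^ 2 := by gcongr
    _ = _ := by ring

/-- The factor `81` is the fixed point of the passage from `9 M` to `M ^ 2`: for `M = 9 s`, `81 s`
becomes `81 s ^ 2`. -/
theorem StronglyKreissBounded.energyBound_two_pow (hT : StronglyKreissBounded T K) (i : ℕ) :
    EnergyBound T (81 * 2 ^ 2 ^ i) ((3 + 72 * K ^ 2) ^ i * (K * 2 ^ 162) ^ 2) := by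
  have hK := hT.nonneg
  induction i with
  | zero =>
    intro x q hq
    have hle : ∀ j ∈ Finset.range q, ‖(T ^ j) x‖ ^ 2 ≤ (K * 2 ^ 162) ^ 2 * ‖x‖ ^ 2 := by
      intro j hj
      have hj' : j + 1 ≤ 162 := by
        have := Finset.mem_range.1 hj
        norm_num at hq
        omega
      rw [← mul_pow]
      gcongr
      calc ‖(T ^ j) x‖ ≤ ‖T ^ j‖ * ‖x‖ := ContinuousLinearMap.le_opNorm _ _
        _ ≤ K * 2 ^ 162 * ‖x‖ := by
          gcongr
          exact (hT.norm_pow_le j).trans (by gcongr; norm_num)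
    refine (Finset.sum_le_card_nsmul _ _ _ hle).trans (le_of_eq ?_)
    rw [Finset.card_range, nsmul_eq_mul]
    ring
  | succ i ih =>
    have h := hT.energyBound_sq (M := 9 * 2 ^ 2 ^ i) (by positivity)
      (fun x q hq => ih x q (by omega))
    intro x q hq
    rw [pow_succ' (3 + 72 * K ^ 2), mul_assoc (3 + 72 * K ^ 2)]
    refine h x q (hq.trans (le_of_eq ?_))
    rw [mul_pow, ← pow_mul, ← pow_succ]
    norm_num

theorem StronglyKreissBounded.adjoint (hT : StronglyKreissBounded T K) :
    StronglyKreissBounded (star T) K := by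
  intro z hz
  have hz' : 1 < ‖star z‖ := by rwa [norm_star]
  obtain ⟨h1, h2⟩ := hT (star z) hz'
  refine ⟨spectrum.star_mem_resolventSet_iff.1 h1, fun n hn => ?_⟩
  have e : resolvent (star T) z = star (resolvent T (star z)) := by
    rw [resolvent, resolvent, ← Ring.inverse_star, star_sub, ← algebraMap_star_comm, star_star]
  have := h2 n hn
  rw [norm_star] at this
  rw [e, ← star_pow, norm_star]
  exact this

/-- `⟨T*^(p - l) y, T ^ l x⟩ = ⟨y, T ^ p x⟩` for every `l ≤ p`. Averaging over a window of about `2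
m` values of `l` just below `p` bounds it by the two energies, each of order `D m`, and the factor
`m` cancels. -/
theorem StronglyKreissBounded.norm_pow_le_of_energyBound (hT : StronglyKreissBounded T K)
    {n p : ℕ} {D : ℝ} (hD : 0 ≤ D) (h : EnergyBound T n D) (h' : EnergyBound (star T) n D)
    (hp : 7 ≤ p) (hn : 12 * (p + 2) ≤ n) : ‖T ^ p‖ ≤ 12 * K * D := by
  have hK := hT.nonneg
  -- This `m` puts the window, whose last index is `(m + 2) ^ 2 - 2`, at or below `p`, while `p - l
  -- ≤ 4 m + 6 < 12 m` on it.
  obtain ⟨m, hm⟩ : ∃ m, Nat.sqrt (p + 2) = m + 2 :=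
    ⟨Nat.sqrt (p + 2) - 2, (Nat.sub_add_cancel (Nat.le_sqrt'.2 (by omega))).symm⟩
  have hm1 : 1 ≤ m := by
    have : 3 ≤ Nat.sqrt (p + 2) := Nat.le_sqrt'.2 (by omega)
    omega
  have hp1 : (m + 2) ^ 2 ≤ p + 2 := hm ▸ Nat.sqrt_le' (p + 2)
  have hp2 : p + 2 < (m + 3) ^ 2 := by
    have := Nat.lt_succ_sqrt' (p + 2)
    rwa [hm] at this
  have hmn : 12 * m ≤ n := by
    have : m + 2 ≤ (m + 2) ^ 2 := Nat.le_self_pow two_ne_zero _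
    omega
  have e2 : (m + 2) ^ 2 = m ^ 2 + 4 * m + 4 := by ring
  have e3 : (m + 3) ^ 2 = m ^ 2 + 6 * m + 9 := by ring
  have e1 : (m + 1) ^ 2 = m ^ 2 + 2 * m + 1 := by ring
  obtain ⟨d, hd⟩ : ∃ d, d + 1 = m ^ 2 := ⟨m ^ 2 - 1, Nat.sub_add_cancel (Nat.one_le_pow _ _ hm1)⟩
  have hm0 : (0 : ℝ) < m := by exact_mod_cast hm1
  have key (x y : X) : ‖inner ℂ y ((T ^ p) x)‖ ≤ 12 * K * D * (‖x‖ * ‖y‖) := by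
    set t := Finset.Ico (m ^ 2 + 2 * m) ((m + 1) ^ 2 + 2 * (m + 1)) with ht
    have hb := hT.norm_sum_inner_orbit_le d (9 * m) x t fun l => (star T ^ (p - l)) y
    have hsum : ∑ l ∈ t, ((∑ j ∈ Finset.range (9 * m),
        if j ≤ l then negBinomial d (l - j) else 0 : ℝ) : ℂ) *
          inner ℂ ((star T ^ (p - l)) y) ((T ^ l) x) =
        ((∑ l ∈ t, ∑ j ∈ Finset.range (9 * m),
          if j ≤ l then negBinomial d (l - j) else 0 : ℝ) : ℂ) * inner ℂ y ((T ^ p) x) := by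
      rw [Complex.ofReal_sum, Finset.sum_mul]
      refine Finset.sum_congr rfl fun l hl => ?_
      rw [Finset.mem_Ico] at hl
      rw [← star_pow, ContinuousLinearMap.star_eq_adjoint, ContinuousLinearMap.adjoint_inner_left,
        ← mul_apply_eq_comp, ← pow_add, Nat.sub_add_cancel (by omega)]
    have hc : (m : ℝ) ≤ ∑ l ∈ t, ∑ j ∈ Finset.range (9 * m),
        if j ≤ l then negBinomial d (l - j) else 0 := by
      have h1 := Finset.card_nsmul_le_sum t (fun l => ∑ j ∈ Finset.range (9 * m),
        if j ≤ l then negBinomial d (l - j) else 0) (1 / 2) fun l hl => by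
          rw [Finset.mem_Ico] at hl
          exact half_le_sum_range_negBinomial hd hl.1 hl.2
      have h2 : 2 * m ≤ t.card := by rw [Nat.card_Ico]; omega
      have h3 : 2 * (m : ℝ) ≤ t.card := by exact_mod_cast h2
      rw [nsmul_eq_mul] at h1
      linarith
    have hV : ∑ l ∈ t, ‖(star T ^ (p - l)) y‖ ^ 2 ≤ D * (12 * m) * ‖y‖ ^ 2 := by
      have hle : ∑ l ∈ t, ‖(star T ^ (p - l)) y‖ ^ 2 ≤ orbitEnergy (star T) y (12 * m) := by
        rw [← Finset.sum_image (f := fun j => ‖(star T ^ j) y‖ ^ 2) (g := fun l => p - l)]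
        · refine Finset.sum_le_sum_of_subset_of_nonneg (fun j hj => ?_) fun _ _ _ => by positivity
          obtain ⟨l, hl, rfl⟩ := Finset.mem_image.1 hj
          rw [Finset.mem_Ico] at hl
          rw [Finset.mem_range]
          omega
        · intro i hi j hj hij
          simp only [ht, Finset.coe_Ico, Set.mem_Ico] at hi hj hij
          omega
      refine hle.trans ((h' y _ hmn).trans (le_of_eq ?_))
      push_cast
      ring
    have hS : orbitEnergy T x (9 * m) ≤ D * (12 * m) * ‖x‖ ^ 2 :=
      (orbitEnergy_mono T x (by omega : 9 * m ≤ 12 * m)).trans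
        ((h x _ hmn).trans (le_of_eq (by push_cast; ring)))
    rw [hsum, norm_mul, Complex.norm_real, Real.norm_of_nonneg (hm0.le.trans hc)] at hb
    have hsq : √(D * (12 * m) * ‖x‖ ^ 2) * √(D * (12 * m) * ‖y‖ ^ 2) =
        D * (12 * m) * (‖x‖ * ‖y‖) := by
      rw [← Real.sqrt_mul (by positivity), ← Real.sqrt_sq
        (by positivity : 0 ≤ D * (12 * m) * (‖x‖ * ‖y‖))]
      congr 1
      ring
    have h1 : (m : ℝ) * ‖inner ℂ y ((T ^ p) x)‖ ≤ m * (12 * K * D * (‖x‖ * ‖y‖)) :=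
      calc (m : ℝ) * ‖inner ℂ y ((T ^ p) x)‖ ≤ _ := mul_le_mul_of_nonneg_right hc (norm_nonneg _)
        _ ≤ _ := hb
        _ ≤ K * (√(D * (12 * m) * ‖x‖ ^ 2) * √(D * (12 * m) * ‖y‖ ^ 2)) := by gcongr
        _ = _ := by rw [hsq]; ring
    exact le_of_mul_le_mul_left h1 hm0
  refine ContinuousLinearMap.opNorm_le_bound _ (by positivity) fun x => ?_
  have h1 := key x ((T ^ p) x)
  rw [inner_self_eq_norm_sq_to_K, norm_pow, RCLike.norm_ofReal, abs_norm] at h1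
  rcases (norm_nonneg ((T ^ p) x)).eq_or_lt with h0 | h0
  · rw [← h0]; positivity
  · rw [sq, ← mul_assoc] at h1
    exact le_of_mul_le_mul_right h1 h0
end Growth

/-! ### Counting the squarings and fixing the constants. -/

theorem exists_le_two_pow_two_pow (n : ℕ) (hn : 1 ≤ n) :
    ∃ i : ℕ, n + 2 ≤ 2 ^ 2 ^ i ∧ (2 : ℝ) ^ i ≤ 6 * Real.log ((n : ℝ) + 2) := by
  have hlog : 1 ≤ Real.log ((n : ℝ) + 2) := by
    rw [Real.le_log_iff_exp_le (by positivity)]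
    have : (1 : ℝ) ≤ n := by exact_mod_cast hn
    linarith [Real.exp_one_lt_d9]
  set y := Nat.clog 2 (n + 2) with hy
  have hy1 : n + 2 ≤ 2 ^ y := Nat.le_pow_clog (by norm_num) _
  have hy2 : 2 ^ (y - 1) < n + 2 := Nat.pow_pred_clog_lt_self one_lt_two (x := n + 2) (by omega)
  have hy0 : 2 ≤ y := by
    by_contra hlt
    have : 2 ^ y ≤ 2 ^ 1 := Nat.pow_le_pow_right (by norm_num) (by omega)
    omega
  have hylog : (y : ℝ) ≤ 3 * Real.log ((n : ℝ) + 2) := by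
    have h1 : (2 : ℝ) ^ (y - 1) ≤ (n : ℝ) + 2 := by exact_mod_cast hy2.le
    have h2 := Real.log_le_log (by positivity) h1
    rw [Real.log_pow, Nat.cast_sub (by omega), Nat.cast_one] at h2
    have h3 : ((y : ℝ) - 1) * (1 / 2) ≤ ((y : ℝ) - 1) * Real.log 2 := by
      have : (2 : ℝ) ≤ y := by exact_mod_cast hy0
      gcongr
      · linarith
      · linarith [Real.log_two_gt_d9]
    linarith
  refine ⟨Nat.clog 2 y, hy1.trans (Nat.pow_le_pow_right (by norm_num)
    (Nat.le_pow_clog (by norm_num) _)), ?_⟩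
  have hi : 2 ^ (Nat.clog 2 y - 1) < y := Nat.pow_pred_clog_lt_self (by norm_num) (by omega)
  have hi0 : 0 < Nat.clog 2 y := Nat.clog_pos (by norm_num) hy0
  have h4 : 2 ^ Nat.clog 2 y ≤ 2 * y := by
    obtain ⟨k, hk⟩ := Nat.exists_eq_succ_of_ne_zero hi0.ne'
    rw [hk] at hi ⊢
    rw [Nat.succ_eq_add_one, Nat.add_sub_cancel] at hi
    rw [pow_succ]
    omega
  have h5 : (2 : ℝ) ^ Nat.clog 2 y ≤ 2 * y := by exact_mod_cast h4
  linarith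

theorem corollary3p4 (K : ℝ) :
    ∃ C β : ℝ, 0 < C ∧ 0 < β ∧
      ∀ (X : Type*) [NormedAddCommGroup X] [InnerProductSpace ℂ X] [CompleteSpace X]
        (T : X →L[ℂ] X), StronglyKreissBounded T K →
          ∀ n : ℕ, 1 ≤ n → ‖T ^ n‖ ≤ C * Real.log ((n : ℝ) + 2) ^ β := by
  -- Chosen so that `i` squarings cost `(3 + 72 K ^ 2) ^ i = (2 ^ i) ^ γ`, where `2 ^ i` is of order
  -- `log n`.
  set γ := Real.logb 2 (3 + 72 * K ^ 2) with hγ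
  have hγ0 : 0 < γ := Real.logb_pos (by norm_num) (by nlinarith [sq_nonneg K])
  set D₀ := (K * 2 ^ 162) ^ 2 with hD₀
  refine ⟨12 * |K| * D₀ * 6 ^ γ + 256 * |K| + 1, γ, by positivity, hγ0, ?_⟩
  intro X _ _ _ T hT n hn
  have hK := hT.nonneg
  rw [abs_of_nonneg hK]
  have hL : 1 ≤ Real.log ((n : ℝ) + 2) := by
    rw [Real.le_log_iff_exp_le (by positivity)]
    have : (1 : ℝ) ≤ n := by exact_mod_cast hn
    linarith [Real.exp_one_lt_d9]
  set L := Real.log ((n : ℝ) + 2) with hLdef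
  have hLγ : 1 ≤ L ^ γ := Real.one_le_rpow hL hγ0.le
  rcases lt_or_ge n 7 with hn7 | hn7
  · calc ‖T ^ n‖ ≤ K * 2 ^ (n + 1) := hT.norm_pow_le n
      _ ≤ K * 2 ^ 8 := by
        gcongr
        · norm_num
        · omega
      _ ≤ (12 * K * D₀ * 6 ^ γ + 256 * K + 1) * 1 := by
        have : 0 ≤ 12 * K * D₀ * 6 ^ γ := by positivity
        linarith
      _ ≤ _ := by gcongr
  · obtain ⟨i, hi, hi'⟩ := exists_le_two_pow_two_pow n hn
    have hb := hT.norm_pow_le_of_energyBound (by positivity) (hT.energyBound_two_pow i)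
      (hT.adjoint.energyBound_two_pow i) hn7 (by omega)
    have hpow : (3 + 72 * K ^ 2) ^ i ≤ 6 ^ γ * L ^ γ := by
      rw [← Real.mul_rpow (by norm_num) (by linarith)]
      calc (3 + 72 * K ^ 2) ^ i = ((2 : ℝ) ^ i) ^ γ := by
            rw [← Real.rpow_natCast 2 i, ← Real.rpow_mul (by norm_num), mul_comm (i : ℝ),
              Real.rpow_mul (by norm_num), Real.rpow_logb (by norm_num) (by norm_num)
              (by positivity), Real.rpow_natCast]
        _ ≤ _ := by gcongr
    calc ‖T ^ n‖ ≤ 12 * K * ((3 + 72 * K ^ 2) ^ i * D₀) := hb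
      _ ≤ 12 * K * ((6 ^ γ * L ^ γ) * D₀) := by gcongr
      _ = 12 * K * D₀ * 6 ^ γ * L ^ γ := by ring
      _ ≤ _ := by gcongr; linarith
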